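/- Let $n,K,m,l$ be nonnegative integers, let $\mathbf{w}\in\mathbb{R}_+^K$ with $\sum_{k=1}^K w_k=1$, and let $\boldsymbol{\xi}$ be a random vector in $\mathbb{R}^n$ whose distribution is the Gaussian mixture $\sum_{k=1}^K w_k\,\mathcal{N}(\boldsymbol{\mu}_k,\boldsymbol{\Sigma}_k)$. Let $\mathbf{c}\in\mathbb{R}^n$, $b\in\mathbb{R}$, $\mathbf{H}\in\mathbb{R}^{m\times n}$, $\mathbf{h}\in\mathbb{R}^m$, $\mathbf{A}\in\mathbb{R}^{l\times n}$, $\mathbf{d}\in\mathbb{R}^l$, $\theta\in(0,1)$, and suppose that $\mathcal{X}=\{\mathbf{x}\in\mathbb{R}^n\mid \mathbf{H}\mathbf{x}=\mathbf{h},\ \mathbf{A}\mathbf{x}\ge\mathbf{d}\}$ is compact. Put $p(\mathbf{x})=\mathbb{P}[\boldsymbol{\xi}^\top\mathbf{x}\le b]$ and, for $\theta'\in\mathbb{R}$, $P(\theta')=\{\mathbf{x}\in\mathcal{X}\mid p(\mathbf{x})\ge\theta'\}$ and $$Z^*(\theta')=\min\{\mathbf{c}^\top\mathbf{x}\mid \mathbf{x}\in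 P(\theta')\}.$$ Assume that: 1. $\boldsymbol{\Sigma}_k$ is (symmetric and) positive definite for every $k$; 2. there exists $\rho>0$ such that $P(\theta')\neq\emptyset$ for all $\theta'\in[\theta-\rho,\theta+\rho]$; 3. if $b=0$, then there exists $\hat\delta>0$ such that $P(\theta)\cap\{\mathbf{x}\mid\|\mathbf{x}\|\le\hat\delta\}=\emptyset$; 4. the linear independence constraint qualification holds at every optimal solution $\mathbf{x}^*$ of $\min\{\mathbf{c}^\top\mathbf{x}\mid\mathbf{x}\in P(\theta)\}$: the rows of $\mathbf{H}$, the rows $\mathbf{A}_i$ of $\mathbf{A}$ with $\mathbf{A}_i\mathbf{x}^*=d_i$, and, if $p(\mathbf{x}^*)=\theta$, the gradient $\nabla p(\mathbf{x}^*)$, together form a linearly independent family. Then the minimum defining $Z^*(\theta')$ is attained for all $\theta'$ in a neighborhood of $\theta$, and the optimal value function $Z^*$ is continuous at $\theta$. -/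

import Mathlib

open MeasureTheory ProbabilityTheory

noncomputable section

namespace ChanceGMM

/-- The `K`-component Gaussian mixture distribution on `ℝⁿ` with weights `w`, means `μ` and
covariance matrices `S`. -/
def gaussianMixture {n K : ℕ} (w : Fin K → ℝ) (μ : Fin K → EuclideanSpace ℝ (Fin n))
    (S : Fin K → Matrix (Fin n) (Fin n) ℝ) : Measure (EuclideanSpace ℝ (Fin n)) :=
  ∑ k, ENNReal.ofReal (w k) • multivariateGaussian (μ k) (S k)

/-- The probability function `p(x) = ℙ[ξᵀ x ≤ b]` of the random vector `ξ`. -/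
def probFun {Ω : Type*} [MeasurableSpace Ω] {n : ℕ} (P : Measure Ω)
    (ξ : Ω → EuclideanSpace ℝ (Fin n)) (b : ℝ) (x : EuclideanSpace ℝ (Fin n)) : ℝ :=
  P.real {ω | inner ℝ (ξ ω) x ≤ b}

/-- The deterministic feasible region `𝒳 = {x ∈ ℝⁿ | H x = h, A x ≥ d}`. -/
def polyhedron {n m l : ℕ} (H : Matrix (Fin m) (Fin n) ℝ) (h : Fin m → ℝ)
    (A : Matrix (Fin l) (Fin n) ℝ) (d : Fin l → ℝ) : Set (EuclideanSpace ℝ (Fin n)) :=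
  {x | H.mulVec x.ofLp = h ∧ ∀ i, d i ≤ A.mulVec x.ofLp i}

/-- The feasible region `P(t) = {x ∈ ℝⁿ | H x = h, A x ≥ d, p(x) ≥ t}`. -/
def feasibleSet {n m l : ℕ} (H : Matrix (Fin m) (Fin n) ℝ) (h : Fin m → ℝ)
    (A : Matrix (Fin l) (Fin n) ℝ) (d : Fin l → ℝ) (p : EuclideanSpace ℝ (Fin n) → ℝ) (t : ℝ) :
    Set (EuclideanSpace ℝ (Fin n)) :=
  {x | x ∈ polyhedron H h A d ∧ t ≤ p x}

/-- The set `{cᵀ x | x ∈ P(t)}` of attainable objective values. -/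
def objectiveValues {n m l : ℕ} (c : EuclideanSpace ℝ (Fin n))
    (H : Matrix (Fin m) (Fin n) ℝ) (h : Fin m → ℝ)
    (A : Matrix (Fin l) (Fin n) ℝ) (d : Fin l → ℝ) (p : EuclideanSpace ℝ (Fin n) → ℝ) (t : ℝ) :
    Set ℝ :=
  (fun x => inner ℝ c x) '' feasibleSet H h A d p t

/-- The optimal value function `Z*(t)`. -/
def optimalValue {n m l : ℕ} (c : EuclideanSpace ℝ (Fin n))
    (H : Matrix (Fin m) (Fin n) ℝ) (h : Fin m → ℝ)
    (A : Matrix (Fin l) (Fin n) ℝ) (d : Fin l → ℝ) (p : EuclideanSpace ℝ (Fin n) → ℝ) (t : ℝ) : ℝ :=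
  sInf (objectiveValues c H h A d p t)

/-- `x` is an optimal solution of `min {cᵀ x | x ∈ P(t)}`. -/
def IsOptimalSolution {n m l : ℕ} (c : EuclideanSpace ℝ (Fin n))
    (H : Matrix (Fin m) (Fin n) ℝ) (h : Fin m → ℝ)
    (A : Matrix (Fin l) (Fin n) ℝ) (d : Fin l → ℝ) (p : EuclideanSpace ℝ (Fin n) → ℝ) (t : ℝ)
    (x : EuclideanSpace ℝ (Fin n)) : Prop :=
  x ∈ feasibleSet H h A d p t ∧ ∀ y ∈ feasibleSet H h A d p t, inner ℝ c x ≤ inner ℝ c y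

/-- The linear independence constraint qualification at `x`: the gradients of all equality
constraints (rows of `H`), of the binding linear inequalities (rows of `A`), and of `p` if the
constraint `p(x) ≥ t` is binding, form a linearly independent family. -/
def LICQ {n m l : ℕ} (H : Matrix (Fin m) (Fin n) ℝ)
    (A : Matrix (Fin l) (Fin n) ℝ) (d : Fin l → ℝ) (p : EuclideanSpace ℝ (Fin n) → ℝ) (t : ℝ)
    (x : EuclideanSpace ℝ (Fin n)) : Prop :=
  LinearIndependent ℝ
    (Sum.elim (fun i : Fin m => WithLp.toLp 2 (H i))
      (Sum.elim (fun i : {i : Fin l // A.mulVec x.ofLp i = d i} => WithLp.toLp 2 (A i.1))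
        (fun _ : {_u : Unit // p x = t} => gradient p x)) :
      Fin m ⊕ ({i : Fin l // A.mulVec x.ofLp i = d i} ⊕ {_u : Unit // p x = t}) →
        EuclideanSpace ℝ (Fin n))

end ChanceGMM

end

namespace ChanceGMM

open Filter Topology

/-! The function `p` is upper semicontinuous because the half-spaces are closed, so each feasible
set is compact and minima exist. Lower semicontinuity of the optimal value is then a compactness
argument (`eventually_lt_optimalValue`). For upper semicontinuity, LICQ lets a minimizer with `p x =
θ` be moved slightly inside the polyhedron so that `p` exceeds `θ`; the moved point stays feasible
for nearby levels and costs little more (`eventually_optimalValue_lt`). -/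

theorem upperSemicontinuous_probFun {Ω : Type*} [MeasurableSpace Ω] (P : Measure Ω)
    [IsFiniteMeasure P] {n : ℕ} {ξ : Ω → EuclideanSpace ℝ (Fin n)} (hξ : AEMeasurable ξ P)
    (b : ℝ) : UpperSemicontinuous (probFun P ξ b) := by
  intro x r hr
  let δ : ℕ → ℝ := fun j => 1 / ((j : ℝ) + 1)
  -- By Cauchy–Schwarz, `E j` contains the event at every `y` within `δ j` of `x`. These sets
  -- decrease to the event at `x`, so continuity from above applies.
  let E : ℕ → Set Ω := fun j => {ω | inner ℝ (ξ ω) x ≤ b + ‖ξ ω‖ * δ j}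
  have hmeas : ∀ j, NullMeasurableSet (E j) P := fun j =>
    nullMeasurableSet_le (hξ.inner_const) ((hξ.norm.mul_const _).const_add b)
  have hδ : Tendsto δ atTop (𝓝 0) := tendsto_one_div_add_atTop_nhds_zero_nat
  have hanti : Antitone E := by
    intro i j hij ω hω
    have h1 : δ j ≤ δ i := Nat.one_div_le_one_div hij
    have h2 := mul_le_mul_of_nonneg_left h1 (norm_nonneg (ξ ω))
    have h3 : inner ℝ (ξ ω) x ≤ b + ‖ξ ω‖ * δ j := hω
    exact h3.trans (by linarith)
  have hInter : ⋂ j, E j = {ω | inner ℝ (ξ ω) x ≤ b} := by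
    ext ω
    simp only [Set.mem_iInter]
    constructor
    · intro hω
      have hlim : Tendsto (fun j => b + ‖ξ ω‖ * δ j) atTop (𝓝 (b + ‖ξ ω‖ * 0)) :=
        (hδ.const_mul _).const_add b
      simpa using ge_of_tendsto' hlim hω
    · intro hω j
      have hpos : 0 < δ j := Nat.one_div_pos_of_nat
      have hω' : inner ℝ (ξ ω) x ≤ b := hω
      exact hω'.trans (le_add_of_nonneg_right (mul_nonneg (norm_nonneg _) hpos.le))
  have hlim : Tendsto (fun j => P.real (E j)) atTop (𝓝 (probFun P ξ b x)) := by
    have h := tendsto_measure_iInter_atTop hmeas hanti ⟨0, measure_ne_top P _⟩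
    rw [hInter] at h
    exact (ENNReal.tendsto_toReal (measure_ne_top P _)).comp h
  obtain ⟨j, hj⟩ := (hlim.eventually (gt_mem_nhds hr)).exists
  filter_upwards [Metric.ball_mem_nhds x (Nat.one_div_pos_of_nat : 0 < δ j)] with y hy
  refine lt_of_le_of_lt (measureReal_mono fun ω hω => ?_) hj
  have h1 : inner ℝ (ξ ω) y ≤ b := hω
  have h2 : inner ℝ (ξ ω) (x - y) ≤ ‖ξ ω‖ * ‖x - y‖ := real_inner_le_norm _ _
  have h3 : ‖x - y‖ ≤ δ j := by
    rw [← dist_eq_norm, dist_comm]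
    exact (Metric.mem_ball.mp hy).le
  have h4 := mul_le_mul_of_nonneg_left h3 (norm_nonneg (ξ ω))
  rw [inner_sub_right] at h2
  show inner ℝ (ξ ω) x ≤ b + ‖ξ ω‖ * δ j
  linarith

/-- If `g` is not in a subspace `K`, then some direction orthogonal to `K` makes a positive inner
product with `g`. -/
theorem exists_orthogonal_inner_pos {E : Type*} [NormedAddCommGroup E] [InnerProductSpace ℝ E]
    (K : Submodule ℝ E) [K.HasOrthogonalProjection] {g : E} (hg : g ∉ K) :
    ∃ v, (∀ u ∈ K, inner ℝ u v = 0) ∧ 0 < inner ℝ g v := by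
  obtain ⟨y, hy, z, hz, rfl⟩ := K.exists_add_mem_mem_orthogonal g
  refine ⟨z, fun u hu => hz u hu, ?_⟩
  have hz0 : z ≠ 0 := by
    rintro rfl
    exact hg (by simpa using hy)
  rw [inner_add_left, hz y hy, zero_add]
  exact real_inner_self_pos.mpr hz0

/-- A function increases along a direction that makes a positive inner product with its
gradient. -/
theorem eventually_lt_add_smul_of_inner_gradient_pos {E : Type*} [NormedAddCommGroup E]
    [InnerProductSpace ℝ E] [CompleteSpace E] {p : E → ℝ} {x v : E}
    (hv : 0 < inner ℝ (gradient p x) v) : ∀ᶠ s : ℝ in 𝓝[>] 0, p x < p (x + s • v) := by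
  -- Without differentiability `gradient` takes the default value `0`, contradicting `hv`.
  have hd : DifferentiableAt ℝ p x := by
    by_contra hnd
    simp [gradient, fderiv_zero_of_not_differentiableAt hnd] at hv
  have hline : HasDerivAt (fun s : ℝ => x + s • v) v 0 := by
    simpa using ((hasDerivAt_id (0 : ℝ)).smul_const v).const_add x
  have hderiv : HasDerivAt (fun s : ℝ => p (x + s • v)) (inner ℝ (gradient p x) v) 0 := by
    have hf : HasFDerivAt p (InnerProductSpace.toDual ℝ E (gradient p x)) (x + (0 : ℝ) • v) := by
      simpa using hd.hasGradientAt.hasFDerivAt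
    exact hf.comp_hasDerivAt (0 : ℝ) hline
  have hslope := hderiv.hasDerivWithinAt (s := Set.Ioi 0)
  rw [hasDerivWithinAt_iff_tendsto_slope' (by simp)] at hslope
  filter_upwards [hslope.eventually (lt_mem_nhds hv), self_mem_nhdsWithin] with s hs hs0
  have hs0 : 0 < s := hs0
  rw [slope_def_field, sub_zero, zero_smul, add_zero, div_pos_iff_of_pos_right hs0] at hs
  linarith

section Feasible

variable {n m l : ℕ} {c : EuclideanSpace ℝ (Fin n)} {H : Matrix (Fin m) (Fin n) ℝ}
  {h : Fin m → ℝ} {A : Matrix (Fin l) (Fin n) ℝ} {d : Fin l → ℝ}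
  {p : EuclideanSpace ℝ (Fin n) → ℝ}

theorem mulVec_apply_eq_inner (M : Matrix (Fin m) (Fin n) ℝ) (x : EuclideanSpace ℝ (Fin n))
    (i : Fin m) : M.mulVec x.ofLp i = inner ℝ (WithLp.toLp 2 (M i)) x := by
  simp [Matrix.mulVec, dotProduct, PiLp.inner_apply, mul_comm]

theorem isCompact_feasibleSet (hX : IsCompact (polyhedron H h A d)) (hp : UpperSemicontinuous p)
    (t : ℝ) : IsCompact (feasibleSet H h A d p t) :=
  hX.inter_right (hp.isClosed_preimage t)

theorem isLeast_optimalValue (hX : IsCompact (polyhedron H h A d)) (hp : UpperSemicontinuous p)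
    {t : ℝ} (hne : (feasibleSet H h A d p t).Nonempty) :
    IsLeast (objectiveValues c H h A d p t) (optimalValue c H h A d p t) :=
  ((isCompact_feasibleSet hX hp t).image (by fun_prop)).isLeast_sInf (hne.image _)

/-- The optimal value function is lower semicontinuous where the problem is feasible. -/
theorem eventually_lt_optimalValue (hX : IsCompact (polyhedron H h A d))
    (hp : UpperSemicontinuous p) {θ : ℝ}
    (hne : ∀ᶠ t in 𝓝 θ, (feasibleSet H h A d p t).Nonempty) {a : ℝ}
    (ha : a < optimalValue c H h A d p θ) : ∀ᶠ t in 𝓝 θ, a < optimalValue c H h A d p t := by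
  have hθ := isLeast_optimalValue (c := c) hX hp hne.self_of_nhds
  let B : Set (EuclideanSpace ℝ (Fin n)) := polyhedron H h A d ∩ {x | inner ℝ c x ≤ a}
  have hB : IsCompact B := hX.inter_right (isClosed_le (by fun_prop) continuous_const)
  -- The maximum of `p` on the compact set `B` is below `θ`, since a point of `B` feasible at `θ`
  -- would have cost at most `a`.
  have hlt : ∀ᶠ t in 𝓝 θ, ∀ x ∈ B, p x < t := by
    rcases B.eq_empty_or_nonempty with hB0 | hB0
    · simp [hB0]
    · obtain ⟨x, hx, hmax⟩ := (hp.upperSemicontinuousOn B).exists_isMaxOn hB0 hB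
      have hxθ : p x < θ := by
        by_contra! hle
        have h1 : optimalValue c H h A d p θ ≤ inner ℝ c x := hθ.2 ⟨x, ⟨hx.1, hle⟩, rfl⟩
        have h2 : inner ℝ c x ≤ a := hx.2
        linarith
      filter_upwards [lt_mem_nhds hxθ] with t ht y hy
      exact lt_of_le_of_lt (hmax hy) ht
  filter_upwards [hlt, hne] with t ht hnet
  obtain ⟨x, hx, hxv⟩ := (isLeast_optimalValue (c := c) hX hp hnet).1
  rw [← hxv]
  by_contra! hle
  exact absurd (ht x ⟨hx.1, hle⟩) (not_lt.mpr hx.2)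

/-- Under LICQ, a point at which the probabilistic constraint binds is a limit, along a ray, of
points of the polyhedron at which the constraint is strictly satisfied. -/
theorem LICQ.exists_direction {t : ℝ} {x : EuclideanSpace ℝ (Fin n)}
    (hL : LICQ H A d p t x) (hx : x ∈ polyhedron H h A d) (hpx : p x = t) :
    ∃ v, ∀ᶠ s : ℝ in 𝓝[>] 0, x + s • v ∈ polyhedron H h A d ∧ t < p (x + s • v) := by
  unfold LICQ at hL
  -- The gradient of `p` lies outside the span of all the other active gradients, so some `v`
  -- orthogonal to them increases `p`.
  have hnot := hL.notMem_span_image (s := {Sum.inr (Sum.inr ⟨(), hpx⟩)}ᶜ)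
    (x := Sum.inr (Sum.inr ⟨(), hpx⟩)) (by simp)
  obtain ⟨v, hv, hgv⟩ := exists_orthogonal_inner_pos _ hnot
  have hHv : ∀ i, inner ℝ (WithLp.toLp 2 (H i)) v = 0 := fun i =>
    hv _ (Submodule.subset_span ⟨Sum.inl i, by simp, rfl⟩)
  have hAv : ∀ i, A.mulVec x.ofLp i = d i → inner ℝ (WithLp.toLp 2 (A i)) v = 0 := fun i hi =>
    hv _ (Submodule.subset_span ⟨Sum.inr (Sum.inl ⟨i, hi⟩), by simp, rfl⟩)
  have hA : ∀ᶠ s : ℝ in 𝓝[>] 0, ∀ i, d i ≤ A.mulVec (x + s • v).ofLp i := by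
    refine eventually_all.mpr fun i => ?_
    simp only [mulVec_apply_eq_inner]
    have hxi := hx.2 i
    rw [mulVec_apply_eq_inner] at hxi
    -- Binding rows stay binding along `v`; the others have slack for small `s`.
    rcases hxi.eq_or_lt with heq | hlt
    · refine Eventually.of_forall fun s => ?_
      rw [inner_add_right, inner_smul_right, hAv i (by rw [mulVec_apply_eq_inner, heq]), ← heq]
      simp
    · have hcont : Tendsto (fun s : ℝ => inner ℝ (WithLp.toLp 2 (A i)) (x + s • v)) (𝓝 0)
          (𝓝 (inner ℝ (WithLp.toLp 2 (A i)) x)) := by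
        have hc : Continuous fun s : ℝ => inner ℝ (WithLp.toLp 2 (A i)) (x + s • v) := by fun_prop
        simpa using hc.tendsto 0
      exact (hcont.eventually (lt_mem_nhds hlt)).filter_mono nhdsWithin_le_nhds |>.mono
        fun s hs => hs.le
  refine ⟨v, ?_⟩
  filter_upwards [hA, eventually_lt_add_smul_of_inner_gradient_pos hgv] with s hsA hsp
  refine ⟨⟨?_, hsA⟩, hpx ▸ hsp⟩
  ext i
  rw [mulVec_apply_eq_inner, inner_add_right, inner_smul_right, hHv i, ← hx.1,
    mulVec_apply_eq_inner]
  simp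

/-- The optimal value function is upper semicontinuous at `θ` under LICQ at an optimal
solution. -/
theorem eventually_optimalValue_lt (hX : IsCompact (polyhedron H h A d))
    (hp : UpperSemicontinuous p) {θ : ℝ} {x : EuclideanSpace ℝ (Fin n)}
    (hx : IsOptimalSolution c H h A d p θ x) (hL : LICQ H A d p θ x) {a : ℝ}
    (ha : inner ℝ c x < a) : ∀ᶠ t in 𝓝 θ, optimalValue c H h A d p t < a := by
  obtain ⟨y, hyX, hyp, hya⟩ :
      ∃ y ∈ polyhedron H h A d, θ < p y ∧ inner ℝ c y < a := by
    rcases hx.1.2.eq_or_lt with heq | hlt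
    · obtain ⟨v, hv⟩ := hL.exists_direction hx.1.1 heq.symm
      have hcont : Tendsto (fun s : ℝ => inner ℝ c (x + s • v)) (𝓝 0) (𝓝 (inner ℝ c x)) := by
        have hc : Continuous fun s : ℝ => inner ℝ c (x + s • v) := by fun_prop
        simpa using hc.tendsto 0
      obtain ⟨s, ⟨hsX, hsp⟩, hsa⟩ := (hv.and
        ((hcont.eventually (gt_mem_nhds ha)).filter_mono nhdsWithin_le_nhds)).exists
      exact ⟨_, hsX, hsp, hsa⟩
    · exact ⟨x, hx.1.1, hlt, ha⟩
  filter_upwards [gt_mem_nhds hyp] with t ht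
  have hyt : y ∈ feasibleSet H h A d p t := ⟨hyX, ht.le⟩
  exact ((isLeast_optimalValue hX hp ⟨y, hyt⟩).2 ⟨y, hyt, rfl⟩).trans_lt hya

end Feasible

end ChanceGMM

theorem lemma4 {Ω : Type*} [MeasurableSpace Ω] (P : Measure Ω) [IsProbabilityMeasure P]
    {n K m l : ℕ}
    -- the Gaussian mixture and the random vector
    (w : Fin K → ℝ) (hw : ∀ k, 0 ≤ w k) (hw_sum : ∑ k, w k = 1)
    (μ : Fin K → EuclideanSpace ℝ (Fin n)) (S : Fin K → Matrix (Fin n) (Fin n) ℝ)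
    (ξ : Ω → EuclideanSpace ℝ (Fin n)) (hξ : HasLaw ξ (ChanceGMM.gaussianMixture w μ S) P)
    -- the remaining data of the problem, with a compact deterministic region
    (c : EuclideanSpace ℝ (Fin n)) (b : ℝ)
    (H : Matrix (Fin m) (Fin n) ℝ) (h : Fin m → ℝ)
    (A : Matrix (Fin l) (Fin n) ℝ) (d : Fin l → ℝ)
    (hX : IsCompact (ChanceGMM.polyhedron H h A d))
    (θ : ℝ) (hθ : θ ∈ Set.Ioo (0 : ℝ) 1)
    -- positive definite covariance matrices
    (h1 : ∀ k, (S k).PosDef)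
    -- feasibility near `θ`
    (h2 : ∃ ρ > 0, ∀ t ∈ Set.Icc (θ - ρ) (θ + ρ),
      (ChanceGMM.feasibleSet H h A d (ChanceGMM.probFun P ξ b) t).Nonempty)
    -- if `b = 0`, the feasible region stays away from the origin
    (h3 : b = 0 → ∃ δ > 0,
      ChanceGMM.feasibleSet H h A d (ChanceGMM.probFun P ξ b) θ ∩
        {x : EuclideanSpace ℝ (Fin n) | ‖x‖ ≤ δ} = ∅)
    -- the constraint qualification at all optimal solutions
    (h4 : ∀ x, ChanceGMM.IsOptimalSolution c H h A d (ChanceGMM.probFun P ξ b) θ x →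
      ChanceGMM.LICQ H A d (ChanceGMM.probFun P ξ b) θ x) :
    -- the minimum exists for every level near `θ`, and the optimal value function is continuous
    (∀ᶠ t in nhds θ, IsLeast (ChanceGMM.objectiveValues c H h A d (ChanceGMM.probFun P ξ b) t)
      (ChanceGMM.optimalValue c H h A d (ChanceGMM.probFun P ξ b) t)) ∧
    ContinuousAt (ChanceGMM.optimalValue c H h A d (ChanceGMM.probFun P ξ b)) θ := by
  have hp := ChanceGMM.upperSemicontinuous_probFun P hξ.aemeasurable b
  obtain ⟨ρ, hρ, hne⟩ := h2
  have hne' : ∀ᶠ t in nhds θ,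
      (ChanceGMM.feasibleSet H h A d (ChanceGMM.probFun P ξ b) t).Nonempty :=
    Filter.mem_of_superset (Icc_mem_nhds (by linarith) (by linarith)) hne
  refine ⟨hne'.mono fun t ht => ChanceGMM.isLeast_optimalValue hX hp ht, ?_⟩
  have hleast := ChanceGMM.isLeast_optimalValue (c := c) hX hp hne'.self_of_nhds
  obtain ⟨x, hx, hxv⟩ := hleast.1
  have hopt : ChanceGMM.IsOptimalSolution c H h A d (ChanceGMM.probFun P ξ b) θ x :=
    ⟨hx, fun y hy => hxv.trans_le (hleast.2 ⟨y, hy, rfl⟩)⟩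
  exact tendsto_order.mpr
    ⟨fun a ha => ChanceGMM.eventually_lt_optimalValue hX hp hne' ha,
      fun a ha => ChanceGMM.eventually_optimalValue_lt hX hp hopt (h4 x hopt) (hxv.trans_lt ha)⟩
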